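/- Let $q>2$ be a prime power, $g=\gcd(3,q-1)$, and let $n\in\{-1,0,1\}$ be defined by $q\equiv n \pmod 3$. Let $V$ be a 3-dimensional vector space over $\mathbb F_{q^3}$, so that the points of $\mathrm{PG}(2,q^3)$ are the 1-dimensional $\mathbb F_{q^3}$-subspaces of $V$. Regard $V$ also as a 9-dimensional vector space over $\mathbb F_q$; then each point $P$ of $\mathrm{PG}(2,q^3)$ is a 3-dimensional $\mathbb F_q$-subspace of $V$, that is, a plane $[\![P]\!]$ of $\mathrm{PG}(8,q)$. These planes form a Desarguesian spread and partition the points of $\mathrm{PG}(8,q)$. Let $\phi$ be a collineation of $\mathrm{PG}(2,q^3)$ of order 3 that fixes every point of some $\mathbb F_q$-plane (a subplane consisting of the points with coordinates in $\mathbb F_q$ with respect to some basis of $V$). Let $\sigma$ be the projectivity of $\mathrm{PG}(8,q)$ induced by $\phi$, that is, the projectivity given by an $\mathbb F_q$-linear bijection $T$ of $V$ with $T^3=\mathrm{id}$ that maps $[\![P]\!]$ to $[\![\phi(P)]\!]$ for every point $P$ of $\mathrm{PG}(2,q^3)$. A point $P$ of $\mathrm{PG}(2,q^3)$ has Type II (respectively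 Type III) if its orbit under $\phi$ consists of three collinear (respectively three non-collinear) points. A point $A$ of $\mathrm{PG}(8,q)$ is called - a fixed point if $A^\sigma=A$; - a II:-point if it lies in $[\![P]\!]$ for some $P$ of Type II, and $A,A^\sigma,A^{\sigma^2}$ are collinear; - a III.:-point if it lies in $[\![P]\!]$ for some $P$ of Type III (then $A,A^\sigma,A^{\sigma^2}$ form a triangle). A fixed-II-line is a line of $\mathrm{PG}(8,q)$ that is fixed by $\sigma$ (as a set) and consists of $n+1$ fixed points and $q-n$ II:-points. A fixed-III-plane is a plane of $\mathrm{PG}(8,q)$ that is fixed by $\sigma$ (as a set) and contains at least one III.:-point. Then the number of fixed-III-planes is $$\frac{q^{3}(q^{2}-1)(q-1)(q^{2}+q+1)}{q^{2}+q+1-g(q-n+1)}.$$ Each fixed-III-plane contains exactly $g$ fixed points, exactly $g(q-n)$ II:-points, exactly $q^{2}+q+1-g(q-n+1)$ III.:-points, and exactly $g$ fixed-II-lines. -/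

import Mathlib

namespace Bose

section PlaneOverK

variable {K V : Type*} [Field K] [AddCommGroup V] [Module K V]

/-- Three points of a projective space are collinear (repetitions allowed). -/
def Collinear (P Q R : Projectivization K V) : Prop :=
  Projectivization.Dependent ![P, Q, R]

/-- Three points of a projective space form a triangle. -/
def Triangle (P Q R : Projectivization K V) : Prop :=
  Projectivization.Independent ![P, Q, R]

/-- A collineation: a permutation of the points that preserves collinearity in both directions. -/
def IsCollineation (φ : Equiv.Perm (Projectivization K V)) : Prop :=
  ∀ P Q R, Collinear P Q R ↔ Collinear (φ P) (φ Q) (φ R)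

/-- `B` is an `F`-plane of the plane `PG(V)` over `K`: the set of points having coordinates in `F`
with respect to some `K`-basis of `V`. -/
def IsSubplane (F : Type*) [Field F] [Algebra F K] (B : Set (Projectivization K V)) : Prop :=
  ∃ b : Module.Basis (Fin 3) K V, B = {P | ∃ (x : Fin 3 → F)
    (hx : ∑ i, algebraMap F K (x i) • b i ≠ 0), P = Projectivization.mk K _ hx}

/-- Type II: the `φ`-orbit consists of three collinear points. -/
def IsTypeII (φ : Equiv.Perm (Projectivization K V)) (P : Projectivization K V) : Prop :=
  P ≠ φ P ∧ P ≠ φ (φ P) ∧ φ P ≠ φ (φ P) ∧ Collinear P (φ P) (φ (φ P))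

/-- Type III: the `φ`-orbit consists of three non-collinear points. -/
def IsTypeIII (φ : Equiv.Perm (Projectivization K V)) (P : Projectivization K V) : Prop :=
  Triangle P (φ P) (φ (φ P))

end PlaneOverK

section FieldReduction

variable {F K V : Type*} [Field F] [Field K] [Algebra F K]
  [AddCommGroup V] [Module K V] [Module F V] [IsScalarTower F K V]

/-- The element `⟦P⟧` of the Desarguesian spread that corresponds to the point `P` of `PG(V)` over
`K`: the same set of vectors, seen as a subspace over `F`. -/
def spreadElement (F : Type*) [Field F] [Algebra F K] [Module F V] [IsScalarTower F K V]
    (P : Projectivization K V) : Submodule F V :=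
  P.submodule.restrictScalars F

/-- The projectivity of `PG(V)` over `F` given by `T` induces the permutation `φ` on the
spread: it maps `⟦P⟧` to `⟦φ P⟧`. -/
def Induces (T : V ≃ₗ[F] V) (φ : Equiv.Perm (Projectivization K V)) : Prop :=
  ∀ P, (spreadElement F P).map (T : V →ₗ[F] V) = spreadElement F (φ P)

/-- The action `σ` of `T` on the points of `PG(V)` over `F`. -/
def sigma (T : V ≃ₗ[F] V) : Projectivization F V → Projectivization F V :=
  Projectivization.map (T : V →ₗ[F] V) T.injective

/-- A subspace of `PG(V)` over `F` is fixed (setwise) by `σ`. -/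
def IsFixed (T : V ≃ₗ[F] V) (U : Submodule F V) : Prop :=
  U.map (T : V →ₗ[F] V) = U

/-- A `II:`-point: a point in a spread element of Type II, with collinear `σ`-orbit. -/
def IsIICollPoint (φ : Equiv.Perm (Projectivization K V)) (T : V ≃ₗ[F] V)
    (A : Projectivization F V) : Prop :=
  (∃ P, IsTypeII φ P ∧ A.submodule ≤ spreadElement F P) ∧
    Collinear A (sigma T A) (sigma T (sigma T A))

/-- A `III.:`-point: a point in a spread element of Type III (its `σ`-orbit is a triangle). -/
def IsIIITriPoint (φ : Equiv.Perm (Projectivization K V)) (T : V ≃ₗ[F] V)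
    (A : Projectivization F V) : Prop :=
  (∃ P, IsTypeIII φ P ∧ A.submodule ≤ spreadElement F P) ∧
    Triangle A (sigma T A) (sigma T (sigma T A))

/-- The fixed points lying in a subspace. -/
def fixedPointsIn (T : V ≃ₗ[F] V) (U : Submodule F V) : Set (Projectivization F V) :=
  {A | A.submodule ≤ U ∧ sigma T A = A}

/-- The `II:`-points lying in a subspace. -/
def iiCollPointsIn (φ : Equiv.Perm (Projectivization K V)) (T : V ≃ₗ[F] V) (U : Submodule F V) :
    Set (Projectivization F V) :=
  {A | A.submodule ≤ U ∧ IsIICollPoint φ T A}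

/-- The `III.:`-points lying in a subspace. -/
def iiiTriPointsIn (φ : Equiv.Perm (Projectivization K V)) (T : V ≃ₗ[F] V) (U : Submodule F V) :
    Set (Projectivization F V) :=
  {A | A.submodule ≤ U ∧ IsIIITriPoint φ T A}

/-- A fixed-II-line: a line fixed by `σ` that consists of `n + 1` fixed points and `q - n`
`II:`-points, where `q` is the order of `F`. -/
def IsFixedIILine (n : ℤ) (φ : Equiv.Perm (Projectivization K V)) (T : V ≃ₗ[F] V)
    (l : Submodule F V) : Prop :=
  Module.finrank F l = 2 ∧ IsFixed T l ∧
    ((fixedPointsIn T l).ncard : ℤ) = n + 1 ∧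
    ((iiCollPointsIn φ T l).ncard : ℤ) = (Nat.card F : ℤ) - n

/-- A fixed-III-plane: a plane fixed by `σ` that contains at least one `III.:`-point. -/
def IsFixedIIIPlane (φ : Equiv.Perm (Projectivization K V)) (T : V ≃ₗ[F] V)
    (U : Submodule F V) : Prop :=
  Module.finrank F U = 3 ∧ IsFixed T U ∧ (iiiTriPointsIn φ T U).Nonempty

end FieldReduction

end Bose

/-! If the orbit of `v` under `T` is independent over K, its F-span `cyc T v` is a copy of F[X]/(X³
- 1), with `v` as 1 and `T` as multiplication by X. The fixed-III-planes are exactly these cyclic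
planes (`isFixedIIIPlane_iff`), so their internal structure is that of this algebra. Fixed points
are eigenvectors, one for each cube root of unity c in F. Invariant lines are the ideals (X - c),
again one for each c. F has g cube roots of unity, and n + 1 roots of X² + X + 1 (`ncard_roots`);
the latter count the fixed points on each invariant line. Every II:-point of the plane lies on
exactly one invariant line, and the points that are neither fixed nor II: are III.:-points. This
gives all the counts inside a plane.

The number of planes comes from double counting. A III.:-point lies in exactly one fixed-III-plane,
the span of its orbit. For the total number of III.:-points, take coordinates in which the points
over F are fixed: `T` acts on each coordinate by one F-linear map α, multiplicative up to a scalar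
(`Induces.exists_coord_map`). Dedekind independence of the characters 1, τ, τ², where τ = α/α(1),
shows that a vector has K-independent orbit iff its coordinates form an F-basis of K
(`linearIndependent_orbit_sum_iff`), so the vectors in question are counted by ordered bases of K.
-/

namespace Bose

/-! ### Points of PG(V) through representing vectors -/

section Points

variable {F V : Type*} [Field F] [AddCommGroup V] [Module F V]

theorem linearIndependent_triple_iff {x y z : V} :
    LinearIndependent F ![x, y, z] ↔
      ∀ a b c : F, a • x + b • y + c • z = 0 → a = 0 ∧ b = 0 ∧ c = 0 := by
  rw [Fintype.linearIndependent_iff]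
  simp only [Fin.sum_univ_three, Matrix.cons_val_zero, Matrix.cons_val_one, Matrix.cons_val]
  constructor
  · intro h a b c habc
    have := h ![a, b, c] (by simpa using habc)
    exact ⟨this 0, this 1, this 2⟩
  · intro h s hs i
    obtain ⟨h0, h1, h2⟩ := h _ _ _ hs
    fin_cases i <;> assumption

theorem range_triple {α : Type*} (x y z : α) : Set.range ![x, y, z] = {x, y, z} := by
  rw [Matrix.range_cons, Matrix.range_cons_cons_empty, Set.singleton_union]

theorem independent_triple_mk {x y z : V} (hx : x ≠ 0) (hy : y ≠ 0) (hz : z ≠ 0) :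
    Projectivization.Independent
      ![Projectivization.mk F x hx, Projectivization.mk F y hy, Projectivization.mk F z hz] ↔
      LinearIndependent F ![x, y, z] := by
  rw [Projectivization.independent_iff]
  obtain ⟨a, ha⟩ := Projectivization.exists_smul_eq_mk_rep F x hx
  obtain ⟨b, hb⟩ := Projectivization.exists_smul_eq_mk_rep F y hy
  obtain ⟨c, hc⟩ := Projectivization.exists_smul_eq_mk_rep F z hz
  have : Projectivization.rep ∘ ![Projectivization.mk F x hx, Projectivization.mk F y hy,
      Projectivization.mk F z hz] = ![a, b, c] • ![x, y, z] := by
    ext i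
    fin_cases i <;> simp [ha, hb, hc]
  rw [this, LinearIndependent.units_smul_iff]

theorem mk_submodule_le {w : V} (hw : w ≠ 0) {U : Submodule F V} :
    (Projectivization.mk F w hw).submodule ≤ U ↔ w ∈ U := by
  rw [Projectivization.submodule_mk, Submodule.span_singleton_le_iff_mem]

/-- The points of a projective space lying in a subspace. -/
def pointsIn (U : Submodule F V) : Set (Projectivization F V) :=
  {A | A.submodule ≤ U}

theorem ncard_pointsIn [Finite F] (U : Submodule F V) :
    (pointsIn U).ncard = ∑ i ∈ Finset.range (Module.finrank F U), Nat.card F ^ i := by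
  rw [← Projectivization.card_of_finrank F U rfl, ← Set.ncard_univ,
    ← Set.ncard_image_of_injective _
      (Projectivization.map_injective U.subtype U.injective_subtype)]
  congr 1
  ext A
  induction A using Projectivization.ind with
  | h w hw =>
    simp only [pointsIn, Set.mem_ofPred_eq, mk_submodule_le, Set.image_univ, Set.mem_range]
    constructor
    · intro h
      exact ⟨Projectivization.mk F ⟨w, h⟩ (by simpa using hw), by
        rw [Projectivization.map_mk]; rfl⟩
    · rintro ⟨B, hB⟩
      induction B using Projectivization.ind with
      | h u hu =>
        rw [Projectivization.map_mk, Projectivization.mk_eq_mk_iff'] at hB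
        obtain ⟨a, ha⟩ := hB
        have hm : a • w ∈ U := ha ▸ u.2
        have ha0 : a ≠ 0 := by
          rintro rfl
          rw [zero_smul] at ha
          exact hu (by simpa using ha.symm)
        exact (U.smul_mem_iff ha0).1 hm

variable {T : V ≃ₗ[F] V}

theorem sigma_mk {w : V} (hw : w ≠ 0) :
    sigma T (Projectivization.mk F w hw) =
      Projectivization.mk F (T w) (by simpa using hw) := by
  simp [sigma, Projectivization.map_mk]

theorem sigma_mk_eq_iff {w : V} (hw : w ≠ 0) :
    sigma T (Projectivization.mk F w hw) = Projectivization.mk F w hw ↔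
      ∃ c : F, T w = c • w := by
  rw [sigma_mk, Projectivization.mk_eq_mk_iff']
  exact ⟨fun ⟨a, h⟩ => ⟨a, h.symm⟩, fun ⟨a, h⟩ => ⟨a, h.symm⟩⟩

theorem triangle_orbit_iff {w : V} (hw : w ≠ 0) :
    Triangle (Projectivization.mk F w hw) (sigma T (Projectivization.mk F w hw))
      (sigma T (sigma T (Projectivization.mk F w hw))) ↔
      LinearIndependent F ![w, T w, T (T w)] := by
  rw [sigma_mk, sigma_mk, Triangle, independent_triple_mk]

theorem collinear_orbit_iff {w : V} (hw : w ≠ 0) :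
    Collinear (Projectivization.mk F w hw) (sigma T (Projectivization.mk F w hw))
      (sigma T (sigma T (Projectivization.mk F w hw))) ↔
      ¬ LinearIndependent F ![w, T w, T (T w)] := by
  rw [← triangle_orbit_iff hw, Collinear, Triangle,
    Projectivization.dependent_iff_not_independent]

end Points

/-! ### Cyclic planes: eigenvectors and invariant lines -/

section Cyclic

variable {F V : Type*} [Field F] [AddCommGroup V] [Module F V] {T : V ≃ₗ[F] V}

theorem IsFixed.map_mem {U : Submodule F V} (hU : IsFixed T U) {u : V} (hu : u ∈ U) : T u ∈ U := by
  have : T u ∈ U.map (T : V →ₗ[F] V) := Submodule.mem_map_of_mem hu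
  rwa [hU] at this

theorem isFixed_of_forall_mem (hT : ∀ v, T (T (T v)) = v) {U : Submodule F V}
    (h : ∀ u ∈ U, T u ∈ U) : IsFixed T U := by
  apply le_antisymm
  · rintro _ ⟨u, hu, rfl⟩
    exact h u hu
  · intro u hu
    exact ⟨T (T u), h _ (h _ hu), hT u⟩

/-- The subspace spanned by the orbit of `v` under `T`, when `T` has order `3`. -/
def cyc (T : V ≃ₗ[F] V) (v : V) : Submodule F V :=
  Submodule.span F {v, T v, T (T v)}

theorem mem_cyc {v w : V} :
    w ∈ cyc T v ↔ ∃ a b c : F, a • v + b • T v + c • T (T v) = w :=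
  Submodule.mem_span_triple

theorem self_mem_cyc (v : V) : v ∈ cyc T v :=
  Submodule.subset_span (by simp)

theorem cyc_le {U : Submodule F V} (hU : IsFixed T U) {v : V} (hv : v ∈ U) : cyc T v ≤ U := by
  rw [cyc, Submodule.span_le]
  rintro x (rfl | rfl | rfl)
  exacts [hv, hU.map_mem hv, hU.map_mem (hU.map_mem hv)]

theorem isFixed_cyc (hT : ∀ v, T (T (T v)) = v) (v : V) : IsFixed T (cyc T v) := by
  refine isFixed_of_forall_mem hT fun u hu => ?_
  obtain ⟨a, b, c, rfl⟩ := mem_cyc.1 hu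
  exact mem_cyc.2 ⟨c, a, b, by simp only [map_add, map_smul, hT]; abel⟩

theorem finrank_cyc {v : V} (hv : LinearIndependent F ![v, T v, T (T v)]) :
    Module.finrank F (cyc T v) = 3 := by
  have := finrank_span_eq_card hv
  rwa [Fintype.card_fin, range_triple] at this

theorem finite_cyc (v : V) : Module.Finite F (cyc T v) :=
  Module.Finite.span_of_finite F (by simp)

theorem finrank_cyc_le_iff {v : V} :
    LinearIndependent F ![v, T v, T (T v)] ↔ 3 ≤ Module.finrank F (cyc T v) := by
  refine ⟨fun h => (finrank_cyc h).ge, fun h => ?_⟩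
  rw [linearIndependent_iff_card_le_finrank_span, Fintype.card_fin]
  rwa [Set.finrank, range_triple]

/-- An invariant plane is recovered from any one of its vectors with independent orbit; hence
distinct fixed-III-planes share no III.:-point. -/
theorem eq_cyc {U : Submodule F V} (hd : Module.finrank F U = 3) (hU : IsFixed T U) {v : V}
    (hvU : v ∈ U) (hv : LinearIndependent F ![v, T v, T (T v)]) : U = cyc T v := by
  have : Module.Finite F U := Module.finite_of_finrank_pos (by omega)
  exact (Submodule.eq_of_le_of_finrank_eq (cyc_le hU hvU) (by rw [finrank_cyc hv, hd])).symm

theorem cube_eq_one_of_eigen (hT : ∀ v, T (T (T v)) = v) {w : V} (hw : w ≠ 0) {c : F}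
    (h : T w = c • w) : c ^ 3 = 1 := by
  have h3 := hT w
  simp only [h, map_smul, smul_smul] at h3
  have : (c * c * c - 1) • w = 0 := by rw [sub_smul, h3, one_smul, sub_self]
  rcases smul_eq_zero.1 this with h | h
  · linear_combination h
  · exact absurd h hw

/-- The eigenvector of `T` with eigenvalue `c` in the cyclic subspace generated by `v`. -/
def eigenVec (T : V ≃ₗ[F] V) (v : V) (c : F) : V :=
  (1 : F) • v + c ^ 2 • T v + c • T (T v)

/-- The invariant line with parameter `c` in the cyclic plane generated by `v`. -/
def invLine (T : V ≃ₗ[F] V) (v : V) (c : F) : Submodule F V :=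
  Submodule.span F {T v - c • v, T (T v) - c • T v}

theorem eigenVec_mem (v : V) (c : F) : eigenVec T v c ∈ cyc T v :=
  mem_cyc.2 ⟨_, _, _, rfl⟩

theorem map_eigenVec (hT : ∀ v, T (T (T v)) = v) (v : V) {c : F} (hc : c ^ 3 = 1) :
    T (eigenVec T v c) = c • eigenVec T v c := by
  simp only [eigenVec, map_add, map_smul, hT, smul_add, smul_smul]
  rw [show c * c ^ 2 = 1 by linear_combination hc]
  module

variable {v : V} (hv : LinearIndependent F ![v, T v, T (T v)])
include hv

theorem eigenVec_ne_zero (c : F) : eigenVec T v c ≠ 0 := fun h =>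
  one_ne_zero (linearIndependent_triple_iff.1 hv _ _ _ h).1

theorem coord_ext {a b c a' b' c' : F}
    (h : a • v + b • T v + c • T (T v) = a' • v + b' • T v + c' • T (T v)) :
    a = a' ∧ b = b' ∧ c = c' := by
  have := linearIndependent_triple_iff.1 hv (a - a') (b - b') (c - c') (by
    rw [← sub_eq_zero] at h
    rw [← h]; module)
  simpa only [sub_eq_zero] using this

/-- `T` shifts the three coordinates cyclically, so the eigenvalue equation determines two of them
from the first: each eigenspace in the plane has dimension at most one. -/
theorem eq_smul_eigenVec (hT : ∀ v, T (T (T v)) = v) {w : V} (hw : w ∈ cyc T v) (hw0 : w ≠ 0)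
    {c : F} (h : T w = c • w) : ∃ a : F, w = a • eigenVec T v c := by
  have hc := cube_eq_one_of_eigen hT hw0 h
  obtain ⟨x, y, z, rfl⟩ := mem_cyc.1 hw
  simp only [map_add, map_smul, hT] at h
  obtain ⟨h1, h2, h3⟩ := coord_ext hv
    (show z • v + x • T v + y • T (T v) = (c * x) • v + (c * y) • T v + (c * z) • T (T v) by
      rw [show z • v + x • T v + y • T (T v) = x • T v + y • T (T v) + z • v by abel, h]
      module)
  refine ⟨x, ?_⟩
  simp only [eigenVec, smul_add, smul_smul]
  rw [show y = x * c ^ 2 by linear_combination c ^ 2 * -h2 - y * hc, show z = x * c by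
    linear_combination h1]
  module

theorem finrank_invLine (c : F) : Module.finrank F (invLine T v c) = 2 := by
  have hli : LinearIndependent F ![T v - c • v, T (T v) - c • T v] := by
    rw [LinearIndependent.pair_iff]
    intro s t hst
    obtain ⟨h1, h2, h3⟩ := linearIndependent_triple_iff.1 hv (-(s * c)) (s - t * c) t (by
      rw [← hst]; module)
    subst h3
    simpa using h2
  have := finrank_span_eq_card hli
  rwa [Fintype.card_fin, Matrix.range_cons_cons_empty] at this

omit hv in
theorem invLine_le (c : F) : invLine T v c ≤ cyc T v := by
  rw [invLine, Submodule.span_le]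
  rintro x (rfl | rfl)
  · exact mem_cyc.2 ⟨-c, 1, 0, by module⟩
  · exact mem_cyc.2 ⟨0, -c, 1, by module⟩

omit hv in
theorem isFixed_invLine (hT : ∀ v, T (T (T v)) = v) {c : F} (hc : c ^ 3 = 1) :
    IsFixed T (invLine T v c) := by
  refine isFixed_of_forall_mem hT fun u hu => ?_
  obtain ⟨a, b, rfl⟩ := Submodule.mem_span_pair.1 hu
  -- Since (X² + cX + c²)(X - c) = X³ - c³ = 0, the vector X²(X - c) is -c²(X - c) - cX(X - c).
  refine Submodule.mem_span_pair.2 ⟨-(b * c ^ 2), a - b * c, ?_⟩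
  simp only [map_add, map_smul, map_sub, hT]
  have : b • v = (b * c ^ 3) • v := by rw [hc, mul_one]
  rw [smul_sub b v, this]
  module

/-- Two different parameters on the same line would put a nonzero multiple of `v`, hence the whole
plane, into that line. -/
theorem invLine_injective (hT : ∀ v, T (T (T v)) = v) {c d : F} (hc : c ^ 3 = 1)
    (h : invLine T v c = invLine T v d) : c = d := by
  by_contra hne
  have h1 : T v - c • v ∈ invLine T v c := Submodule.subset_span (by simp)
  have h2 : T v - d • v ∈ invLine T v c := h ▸ Submodule.subset_span (by simp)
  have h3 : (c - d) • v ∈ invLine T v c := by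
    have := sub_mem h2 h1
    rwa [show T v - d • v - (T v - c • v) = (c - d) • v by module] at this
  have h4 := cyc_le (isFixed_invLine hT hc)
    ((Submodule.smul_mem_iff _ (sub_ne_zero.2 hne)).1 h3)
  have : Module.Finite F (invLine T v c) :=
    Module.finite_of_finrank_pos (by rw [finrank_invLine hv]; norm_num)
  have := Submodule.finrank_mono h4
  rw [finrank_cyc hv, finrank_invLine hv] at this
  omega

/-- The invariant lines of a cyclic plane are the lines `invLine T v c`. -/
theorem exists_eq_invLine (hT : ∀ v, T (T (T v)) = v) {l : Submodule F V} (hl : l ≤ cyc T v)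
    (hd : Module.finrank F l = 2) (hfix : IsFixed T l) :
    ∃ c : F, c ^ 3 = 1 ∧ l = invLine T v c := by
  have hfl : Module.Finite F l := Module.finite_of_finrank_pos (by omega)
  have hfc := finite_cyc (F := F) (T := T) v
  have hvl : v ∉ l := fun h => by
    have := Submodule.finrank_mono (cyc_le hfix h)
    rw [finrank_cyc hv] at this
    omega
  have hsup : l ⊔ Submodule.span F {v} = cyc T v := by
    have hle : l ⊔ Submodule.span F {v} ≤ cyc T v :=
      sup_le hl (by simpa using self_mem_cyc v)
    refine Submodule.eq_of_le_of_finrank_le hle ?_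
    rw [finrank_cyc hv]
    have hfs : Module.Finite F ↥(l ⊔ Submodule.span F {v}) := Submodule.finiteDimensional_sup _ _
    have : l < l ⊔ Submodule.span F {v} := by
      refine lt_of_le_of_ne le_sup_left fun h => hvl ?_
      rw [h]
      exact Submodule.mem_sup_right (Submodule.mem_span_singleton_self v)
    have := Submodule.finrank_lt_finrank_of_lt this
    omega
  have hTv : T v ∈ l ⊔ Submodule.span F {v} := by
    rw [hsup]
    exact (isFixed_cyc hT v).map_mem (self_mem_cyc v)
  -- The parameter c is the scalar by which `T` acts on the one-dimensional quotient of the plane by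
  -- l.
  obtain ⟨x, hx, y, hy, hxy⟩ := Submodule.mem_sup.1 hTv
  obtain ⟨c, rfl⟩ := Submodule.mem_span_singleton.1 hy
  have hx' : T v - c • v = x := by rw [← hxy]; abel
  have hle : invLine T v c ≤ l := by
    rw [invLine, Submodule.span_le]
    rintro u (rfl | rfl)
    · rw [hx']; exact hx
    · rw [← map_smul, ← map_sub, hx']
      exact hfix.map_mem hx
  refine ⟨c, ?_, (Submodule.eq_of_le_of_finrank_eq hle
    (by rw [finrank_invLine hv, hd])).symm⟩
  have h3 : (1 - c ^ 3) • v ∈ l := by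
    -- Apply X³ - c³ = (X² + cX + c²)(X - c) to `v`, with x = (X - c)v.
    have e : (1 - c ^ 3) • v = T (T x) + c • T x + c ^ 2 • x := by
      rw [← hx']
      simp only [map_sub, map_smul, hT]
      module
    rw [e]
    have h1 := hfix.map_mem hx
    exact add_mem (add_mem (hfix.map_mem h1) (l.smul_mem _ h1)) (l.smul_mem _ hx)
  by_contra hne
  exact hvl ((Submodule.smul_mem_iff _ (sub_ne_zero.2 (Ne.symm hne))).1 h3)

/-- The line is the ideal of polynomials vanishing at c, and the eigenvector is 1 + e²X + eX², whose
value at c is c(e² + ce + c²) because c³ = 1. -/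
theorem eigenVec_mem_invLine_iff {c e : F} (hc : c ^ 3 = 1) :
    eigenVec T v e ∈ invLine T v c ↔ e ^ 2 + c * e + c ^ 2 = 0 := by
  rw [invLine, Submodule.mem_span_pair]
  constructor
  · rintro ⟨a, b, h⟩
    obtain ⟨h1, h2, h3⟩ := coord_ext hv
      (show (-(a * c)) • v + (a - b * c) • T v + b • T (T v) = _ from
        Eq.trans (by module) h)
    linear_combination -h2 - c * h3 - c ^ 2 * h1 - a * hc
  · intro h
    refine ⟨e ^ 2 + c * e, e, ?_⟩
    have h1 : (-(c * (e ^ 2 + c * e))) = 1 := by linear_combination (-c) * h + hc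
    rw [eigenVec, ← h1]
    module

end Cyclic

/-! ### Cube roots of unity in a finite field -/

section CubeRoots

variable {F : Type*} [Field F]

theorem cube_eq_one_iff {c : F} : c ^ 3 = 1 ↔ c = 1 ∨ c ^ 2 + c + 1 = 0 := by
  rw [← sub_eq_zero, ← sub_eq_zero (a := c), ← mul_eq_zero]
  ring_nf

theorem three_dvd_card_iff [Finite F] : 3 ∣ Nat.card F ↔ (3 : F) = 0 := by
  have := Fintype.ofFinite F
  rw [Nat.card_eq_fintype_card]
  constructor
  · intro h
    obtain ⟨p, hp, k, hpp, hk⟩ := FiniteField.card' F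
    rw [hk] at h
    have h3 : 3 = p := (Nat.prime_dvd_prime_iff_eq Nat.prime_three hpp).1
      (Nat.prime_three.dvd_of_dvd_pow h)
    subst h3
    exact_mod_cast CharP.cast_eq_zero F 3
  · intro h
    have : CharP F 3 := by
      obtain ⟨p, hp⟩ := CharP.exists F
      have h3 : p ∣ 3 := (CharP.cast_eq_zero_iff F p 3).1 (by exact_mod_cast h)
      rcases (Nat.dvd_prime Nat.prime_three).1 h3 with rfl | rfl
      · exact absurd (CharP.cast_eq_zero F 1) (by rw [Nat.cast_one]; exact one_ne_zero)
      · exact hp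
    exact (CharP.cast_eq_zero_iff F 3 _).1 (FiniteField.cast_card_eq_zero F)

theorem three_dvd_card_sub_one_of_root [Finite F] (h3 : (3 : F) ≠ 0) {c : F}
    (h : c ^ 2 + c + 1 = 0) : 3 ∣ Nat.card F - 1 := by
  have hc3 : c ^ 3 = 1 := cube_eq_one_iff.2 (Or.inr h)
  have hc0 : c ≠ 0 := by rintro rfl; simp at h
  have : orderOf (Units.mk0 c hc0) = 3 := by
    have : Fact (Nat.Prime 3) := ⟨Nat.prime_three⟩
    refine orderOf_eq_prime (Units.ext (by simpa using hc3)) fun h1 => h3 ?_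
    have h1' : c = 1 := by simpa using congrArg Units.val h1
    rw [h1'] at h
    linear_combination h
  rw [← this, ← Nat.card_units]
  exact orderOf_dvd_natCard _

theorem exists_root_of_three_dvd [Finite F] (h : 3 ∣ Nat.card F - 1) :
    ∃ c : F, c ≠ 1 ∧ c ^ 2 + c + 1 = 0 := by
  have : Fact (Nat.Prime 3) := ⟨Nat.prime_three⟩
  obtain ⟨u, hu⟩ := exists_prime_orderOf_dvd_card' (G := Fˣ) 3 (by rwa [Nat.card_units])
  have h1 : (u : F) ≠ 1 := fun h => by
    rw [Units.val_eq_one] at h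
    simp [h] at hu
  have h3 : (u : F) ^ 3 = 1 := by
    have := pow_orderOf_eq_one u
    rw [hu] at this
    rw [← Units.val_pow_eq_pow_val, this, Units.val_one]
  exact ⟨u, h1, (cube_eq_one_iff.1 h3).resolve_left h1⟩

/-- X² + X + 1 has the single root 1 in characteristic 3, two roots different from 1 if q ≡ 1, and
none if q ≡ -1 modulo 3. Adjoining 1 gives all cube roots of unity. -/
theorem ncard_roots [Finite F] {g : ℕ} (hg : g = Nat.gcd 3 (Nat.card F - 1))
    {n : ℤ} (hn : n = -1 ∨ n = 0 ∨ n = 1) (hqn : (Nat.card F : ℤ) ≡ n [ZMOD 3]) :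
    ({c : F | c ^ 2 + c + 1 = 0}.ncard : ℤ) = n + 1 ∧ {c : F | c ^ 3 = 1}.ncard = g := by
  have hq1 : 1 < Nat.card F := Finite.one_lt_card
  simp only [cube_eq_one_iff]
  unfold Int.ModEq at hqn
  have hcop : ¬ 3 ∣ Nat.card F - 1 → g = 1 := fun h => by
    rw [hg]; exact (Nat.Prime.coprime_iff_not_dvd Nat.prime_three).2 h
  by_cases h3 : (3 : F) = 0
  · have hd := three_dvd_card_iff.2 h3
    have hn0 : n = 0 := by omega
    have hR : {c : F | c ^ 2 + c + 1 = 0} = {1} := by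
      ext c
      simp only [Set.mem_ofPred_eq, Set.mem_singleton_iff]
      have : c ^ 2 + c + 1 = (c - 1) ^ 2 := by linear_combination c * h3
      rw [this, sq_eq_zero_iff, sub_eq_zero]
    have hE : {c : F | c = 1 ∨ c ^ 2 + c + 1 = 0} = {1} := by
      rw [Set.ofPred_or, hR]
      simp
    rw [hR, hE, Set.ncard_singleton, hcop (by omega), hn0]
    simp
  · have hd := mt three_dvd_card_iff.1 h3
    by_cases hd1 : 3 ∣ Nat.card F - 1
    · obtain ⟨u, hu1, hu⟩ := exists_root_of_three_dvd hd1
      have hR : {c : F | c ^ 2 + c + 1 = 0} = {u, u ^ 2} := by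
        ext c
        simp only [Set.mem_ofPred_eq, Set.mem_insert_iff, Set.mem_singleton_iff]
        rw [← sub_eq_zero (a := c) (b := u), ← sub_eq_zero (a := c) (b := u ^ 2), ← mul_eq_zero]
        have : (c - u) * (c - u ^ 2) = c ^ 2 + c + 1 := by
          linear_combination (-c + u - 1) * hu
        rw [this]
      have hne : u ≠ u ^ 2 := fun h => by
        have hu0 : u ≠ 0 := by rintro rfl; simp at hu
        exact hu1 (mul_left_cancel₀ hu0 (by linear_combination -h))
      have hE : {c : F | c = 1 ∨ c ^ 2 + c + 1 = 0} = insert 1 {u, u ^ 2} := by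
        rw [← hR]; rfl
      have h1 : (1 : F) ∉ ({u, u ^ 2} : Set F) := by
        rw [← hR, Set.mem_ofPred_eq]
        intro h
        exact h3 (by linear_combination h)
      rw [hE, Set.ncard_insert_of_notMem h1, hR, Set.ncard_pair hne, hg,
        Nat.gcd_eq_left hd1]
      refine ⟨?_, rfl⟩
      push_cast
      omega
    · have hR : {c : F | c ^ 2 + c + 1 = 0} = ∅ := by
        ext c
        simp only [Set.mem_ofPred_eq, Set.mem_empty_iff_false, iff_false]
        exact fun h => hd1 (three_dvd_card_sub_one_of_root h3 h)
      have hE : {c : F | c = 1 ∨ c ^ 2 + c + 1 = 0} = {1} := by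
        rw [Set.ofPred_or, hR]
        simp
      rw [hR, hE, Set.ncard_singleton, hcop hd1, Set.ncard_empty]
      refine ⟨?_, rfl⟩
      push_cast
      omega

end CubeRoots

/-! ### Fixed points in a cyclic plane and on its invariant lines -/

section FixedPoints

variable {F V : Type*} [Field F] [AddCommGroup V] [Module F V] {T : V ≃ₗ[F] V}
  {v : V} (hv : LinearIndependent F ![v, T v, T (T v)])

/-- The point spanned by `eigenVec T v c`. -/
def eigenPoint (c : F) : Projectivization F V :=
  Projectivization.mk F (eigenVec T v c) (eigenVec_ne_zero hv c)

theorem eigenPoint_injective : Function.Injective (eigenPoint hv) := by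
  intro c d h
  obtain ⟨a, ha⟩ := (Projectivization.mk_eq_mk_iff' ..).1 h
  obtain ⟨h1, -, h3⟩ := coord_ext hv
    (show (a * 1) • v + (a * d ^ 2) • T v + (a * d) • T (T v) =
      (1 : F) • v + c ^ 2 • T v + c • T (T v) by
      rw [← eigenVec, ← ha, eigenVec]; module)
  linear_combination d * h1 - h3

theorem fixedPointsIn_eq (hT : ∀ v, T (T (T v)) = v) {l : Submodule F V} (hl : l ≤ cyc T v) :
    fixedPointsIn T l = eigenPoint hv '' {c | c ^ 3 = 1 ∧ eigenVec T v c ∈ l} := by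
  ext A
  constructor
  · induction A using Projectivization.ind with
    | h w hw =>
      rintro ⟨hA, hfix⟩
      rw [mk_submodule_le] at hA
      obtain ⟨c, hc⟩ := (sigma_mk_eq_iff hw).1 hfix
      obtain ⟨a, ha⟩ := eq_smul_eigenVec hv hT (hl hA) hw hc
      have ha0 : a ≠ 0 := by
        rintro rfl
        rw [zero_smul] at ha
        exact hw ha
      refine ⟨c, ⟨cube_eq_one_of_eigen hT hw hc, ?_⟩, ?_⟩
      · exact (l.smul_mem_iff ha0).1 (ha ▸ hA)
      · exact (Projectivization.mk_eq_mk_iff' ..).2 ⟨a⁻¹, by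
          rw [ha, smul_smul, inv_mul_cancel₀ ha0, one_smul]⟩
  · rintro ⟨c, ⟨hc, hcl⟩, rfl⟩
    exact ⟨(mk_submodule_le _).2 hcl, (sigma_mk_eq_iff _).2 ⟨c, map_eigenVec hT v hc⟩⟩

include hv in
theorem ncard_fixedPointsIn_cyc (hT : ∀ v, T (T (T v)) = v) :
    (fixedPointsIn T (cyc T v)).ncard = {c : F | c ^ 3 = 1}.ncard := by
  rw [fixedPointsIn_eq hv hT le_rfl, Set.ncard_image_of_injective _ (eigenPoint_injective hv)]
  simp only [eigenVec_mem, and_true]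

include hv in
-- The substitution e = cu turns e² + ce + c² into c²(u² + u + 1), so the count does not depend on
-- the line.
theorem ncard_fixedPointsIn_invLine (hT : ∀ v, T (T (T v)) = v) {c : F} (hc : c ^ 3 = 1) :
    (fixedPointsIn T (invLine T v c)).ncard = {c : F | c ^ 2 + c + 1 = 0}.ncard := by
  have hc0 : c ≠ 0 := by rintro rfl; simp at hc
  have hset : {e : F | e ^ 3 = 1 ∧ eigenVec T v e ∈ invLine T v c} =
      (c * ·) '' {c : F | c ^ 2 + c + 1 = 0} := by
    ext e
    simp only [Set.mem_ofPred_eq, eigenVec_mem_invLine_iff hv hc, Set.mem_image]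
    constructor
    · rintro ⟨-, he⟩
      refine ⟨e / c, ?_, by field_simp⟩
      field_simp
      linear_combination he
    · rintro ⟨u, hu, rfl⟩
      refine ⟨?_, by linear_combination c ^ 2 * hu⟩
      rw [mul_pow, hc, one_mul]
      exact cube_eq_one_iff.2 (Or.inr hu)
  rw [fixedPointsIn_eq hv hT (invLine_le c),
    Set.ncard_image_of_injective _ (eigenPoint_injective hv), hset,
    Set.ncard_image_of_injective _ (mul_right_injective₀ hc0)]

end FixedPoints

/-! ### Types of the points of a cyclic plane -/

section FieldReduction

variable {F K V : Type*} [Field F] [Field K] [Algebra F K]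
  [AddCommGroup V] [Module K V] [Module F V] [IsScalarTower F K V]
  {φ : Equiv.Perm (Projectivization K V)} {T : V ≃ₗ[F] V}

theorem mk_submodule_le_spreadElement {w : V} (hw : w ≠ 0) {P : Projectivization K V} :
    (Projectivization.mk F w hw).submodule ≤ spreadElement F P ↔
      P = Projectivization.mk K w hw := by
  rw [mk_submodule_le, spreadElement, Submodule.restrictScalars_mem]
  induction P using Projectivization.ind with
  | h u hu =>
    rw [Projectivization.submodule_mk, Submodule.mem_span_singleton,
      eq_comm (a := Projectivization.mk K u hu), Projectivization.mk_eq_mk_iff']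

theorem Induces.apply_mk (h : Induces T φ) {w : V} (hw : w ≠ 0) :
    φ (Projectivization.mk K w hw) = Projectivization.mk K (T w) (by simpa using hw) := by
  rw [← mk_submodule_le_spreadElement (F := F), ← h, mk_submodule_le]
  refine Submodule.mem_map_of_mem ?_
  rw [spreadElement, Submodule.restrictScalars_mem, Projectivization.submodule_mk]
  exact Submodule.mem_span_singleton_self w

theorem isTypeIII_mk_iff (h : Induces T φ) {w : V} (hw : w ≠ 0) :
    IsTypeIII φ (Projectivization.mk K w hw) ↔ LinearIndependent K ![w, T w, T (T w)] := by
  rw [IsTypeIII, h.apply_mk, h.apply_mk, Triangle, independent_triple_mk]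

theorem isIIITriPoint_mk_iff (h : Induces T φ) {w : V} (hw : w ≠ 0) :
    IsIIITriPoint φ T (Projectivization.mk F w hw) ↔
      LinearIndependent K ![w, T w, T (T w)] := by
  rw [IsIIITriPoint, triangle_orbit_iff]
  simp only [mk_submodule_le_spreadElement, exists_eq_right, isTypeIII_mk_iff h]
  exact and_iff_left_of_imp fun hK => hK.restrict_scalars' F

/-- If the orbit of `w` is F-independent, its F-span is the whole cyclic plane and contains the
K-basis given by the orbit of `v`; three vectors spanning V over K are independent. -/
theorem linearIndependent_orbit_iff (hV : Module.finrank K V = 3) {v w : V}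
    (hv : LinearIndependent K ![v, T v, T (T v)]) (hT : ∀ v, T (T (T v)) = v)
    (hw : w ∈ cyc T v) :
    LinearIndependent F ![w, T w, T (T w)] ↔ LinearIndependent K ![w, T w, T (T w)] := by
  refine ⟨fun hwF => ?_, fun hK => hK.restrict_scalars' F⟩
  have : FiniteDimensional K V := Module.finite_of_finrank_pos (by omega)
  refine linearIndependent_of_top_le_span_of_card_eq_finrank ?_ (by rw [hV, Fintype.card_fin])
  rw [← hv.span_eq_top_of_card_eq_finrank' (by rw [hV, Fintype.card_fin]), Submodule.span_le,
    range_triple, range_triple]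
  have hcyc : cyc T v = cyc T w :=
    eq_cyc (finrank_cyc (hv.restrict_scalars' F)) (isFixed_cyc hT v) hw hwF
  have hsub : (cyc T v : Set V) ⊆ Submodule.span K {w, T w, T (T w)} := by
    rw [hcyc]
    exact Submodule.span_subset_span F K _
  exact subset_trans Submodule.subset_span hsub

/-- Coordinates of `w` in the orbit basis lie in F, and the eigenvalue is a quotient of two of them.
So a point of the plane whose spread element is fixed is itself fixed. -/
theorem exists_eigenvalue_of_mem_cyc {v w : V}
    (hv : LinearIndependent K ![v, T v, T (T v)]) (hT : ∀ v, T (T (T v)) = v)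
    (hw : w ∈ cyc T v) (hw0 : w ≠ 0) {k : K} (hk : T w = k • w) : ∃ c : F, T w = c • w := by
  obtain ⟨x, y, z, rfl⟩ := mem_cyc.1 hw
  have hk' := hk
  simp only [map_add, map_smul, hT] at hk'
  simp only [← algebraMap_smul K (_ : F)] at hk'
  obtain ⟨h1, h2, h3⟩ := linearIndependent_triple_iff.1 hv
    (algebraMap F K z - k * algebraMap F K x) (algebraMap F K x - k * algebraMap F K y)
    (algebraMap F K y - k * algebraMap F K z) (by
      rw [← sub_eq_zero] at hk'
      rw [← hk']
      module)
  have hx : x ≠ 0 := by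
    rintro rfl
    have hz : z = 0 := by simpa using h1
    subst hz
    have hy : y = 0 := by simpa using h3
    subst hy
    simp at hw0
  have hx' : algebraMap F K x ≠ 0 := by simpa using hx
  have hkz : k = algebraMap F K (z / x) := by
    rw [map_div₀, eq_div_iff hx']
    linear_combination -h1
  exact ⟨z / x, by rw [hk, hkz, algebraMap_smul]⟩

theorem isIICollPoint_mk_iff (h : Induces T φ) (hT : ∀ v, T (T (T v)) = v) {v w : V}
    (hv : LinearIndependent K ![v, T v, T (T v)]) (hw : w ∈ cyc T v) (hw0 : w ≠ 0) :
    IsIICollPoint φ T (Projectivization.mk F w hw0) ↔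
      sigma T (Projectivization.mk F w hw0) ≠ Projectivization.mk F w hw0 ∧
        ¬ LinearIndependent F ![w, T w, T (T w)] := by
  rw [IsIICollPoint, collinear_orbit_iff]
  simp only [mk_submodule_le_spreadElement, exists_eq_right]
  refine and_congr_left fun hdep => ?_
  rw [Ne, sigma_mk_eq_iff]
  have h3 : φ (φ (φ (Projectivization.mk K w hw0))) = Projectivization.mk K w hw0 := by
    simp only [h.apply_mk, hT]
  constructor
  · rintro ⟨h1, -⟩ ⟨c, hc⟩
    refine h1 ?_
    rw [h.apply_mk, eq_comm, Projectivization.mk_eq_mk_iff']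
    exact ⟨algebraMap F K c, by rw [hc, algebraMap_smul]⟩
  · intro hne
    have h1 : Projectivization.mk K w hw0 ≠ φ (Projectivization.mk K w hw0) := by
      intro he
      rw [h.apply_mk, eq_comm, Projectivization.mk_eq_mk_iff'] at he
      obtain ⟨k, hk⟩ := he
      exact hne (exists_eigenvalue_of_mem_cyc hv hT hw hw0 hk.symm)
    refine ⟨h1, fun he => h1 (h3.symm.trans (congrArg φ he.symm)),
      fun he => h1 (φ.injective he), ?_⟩
    rw [h.apply_mk, h.apply_mk, Collinear, Projectivization.dependent_iff_not_independent,
      independent_triple_mk]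
    exact fun hK => hdep (hK.restrict_scalars' F)

section Plane

variable (h : Induces T φ) (hT : ∀ v, T (T (T v)) = v) {v : V}
  (hv : LinearIndependent K ![v, T v, T (T v)])
include h hT hv

/-- The orbit of a point of an invariant line stays on that line, so it cannot be a triangle. -/
theorem iiCollPointsIn_of_line {l : Submodule F V} (hl : l ≤ cyc T v)
    (hd : Module.finrank F l = 2) (hfix : IsFixed T l) :
    iiCollPointsIn φ T l = pointsIn l \ fixedPointsIn T l := by
  have hfl : Module.Finite F l := Module.finite_of_finrank_pos (by omega)
  ext A
  induction A using Projectivization.ind with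
  | h w hw0 =>
    simp only [iiCollPointsIn, pointsIn, fixedPointsIn, Set.mem_sdiff, Set.mem_ofPred_eq,
      mk_submodule_le]
    constructor
    · rintro ⟨hw, hII⟩
      rw [isIICollPoint_mk_iff h hT hv (hl hw)] at hII
      exact ⟨hw, fun hf => hII.1 hf.2⟩
    · rintro ⟨hw, hf⟩
      refine ⟨hw, (isIICollPoint_mk_iff h hT hv (hl hw) hw0).2 ⟨fun he => hf ⟨hw, he⟩, ?_⟩⟩
      intro hli
      have := Submodule.finrank_mono (cyc_le hfix hw)
      rw [finrank_cyc hli] at this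
      omega

theorem ncard_iiCollPointsIn_invLine [Finite F] {c : F} (hc : c ^ 3 = 1) {n : ℤ}
    (hn : ({c : F | c ^ 2 + c + 1 = 0}.ncard : ℤ) = n + 1) :
    ((iiCollPointsIn φ T (invLine T v c)).ncard : ℤ) = Nat.card F - n := by
  have hvF : LinearIndependent F ![v, T v, T (T v)] := hv.restrict_scalars' F
  rw [iiCollPointsIn_of_line h hT hv (invLine_le c) (finrank_invLine hvF c)
    (isFixed_invLine hT hc)]
  have hp := ncard_pointsIn (invLine T v c)
  rw [finrank_invLine hvF c] at hp
  simp only [Finset.sum_range_succ, Finset.sum_range_zero, pow_zero, pow_one] at hp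
  have hfin : (pointsIn (invLine T v c)).Finite := Set.finite_of_ncard_pos (by omega)
  have hsub : fixedPointsIn T (invLine T v c) ⊆ pointsIn (invLine T v c) := fun A hA => hA.1
  have := Set.ncard_sdiff_add_ncard_of_subset hsub hfin
  rw [← ncard_fixedPointsIn_invLine hvF hT hc] at hn
  omega

/-- Every invariant line of the plane has the required numbers of points, so invariance is the only
condition left. -/
theorem isFixedIILine_iff [Finite F] {n : ℤ}
    (hn : ({c : F | c ^ 2 + c + 1 = 0}.ncard : ℤ) = n + 1) :
    {l : Submodule F V | l ≤ cyc T v ∧ IsFixedIILine n φ T l} =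
      invLine T v '' {c | c ^ 3 = 1} := by
  have hvF : LinearIndependent F ![v, T v, T (T v)] := hv.restrict_scalars' F
  ext l
  constructor
  · rintro ⟨hl, hd, hfix, -⟩
    obtain ⟨c, hc, rfl⟩ := exists_eq_invLine hvF hT hl hd hfix
    exact ⟨c, hc, rfl⟩
  · rintro ⟨c, hc, rfl⟩
    exact ⟨invLine_le c, finrank_invLine hvF c, isFixed_invLine hT hc,
      by rw [ncard_fixedPointsIn_invLine hvF hT hc, hn],
      ncard_iiCollPointsIn_invLine h hT hv hc hn⟩

theorem ncard_isFixedIILine [Finite F] {n : ℤ}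
    (hn : ({c : F | c ^ 2 + c + 1 = 0}.ncard : ℤ) = n + 1) :
    {l : Submodule F V | l ≤ cyc T v ∧ IsFixedIILine n φ T l}.ncard =
      {c : F | c ^ 3 = 1}.ncard := by
  rw [isFixedIILine_iff h hT hv hn]
  exact Set.InjOn.ncard_image fun c hc d _ hcd =>
    invLine_injective (hv.restrict_scalars' F) hT hc hcd

/-- A `II:`-point of a cyclic plane spans an invariant line together with its orbit. -/
theorem exists_invLine_of_iiCollPoint {w : V} (hw : w ∈ cyc T v) (hw0 : w ≠ 0)
    (hII : IsIICollPoint φ T (Projectivization.mk F w hw0)) :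
    ∃ c : F, c ^ 3 = 1 ∧ cyc T w = invLine T v c := by
  rw [isIICollPoint_mk_iff h hT hv hw, Ne, sigma_mk_eq_iff] at hII
  obtain ⟨hne, hdep⟩ := hII
  have hle := cyc_le (isFixed_cyc hT v) hw
  have hfw := finite_cyc (F := F) (T := T) w
  refine exists_eq_invLine (hv.restrict_scalars' F) hT hle ?_ (isFixed_cyc hT w)
  refine le_antisymm ?_ ?_
  · by_contra hlt
    exact hdep (finrank_cyc_le_iff.2 (by omega))
  · have hp : LinearIndependent F ![w, T w] := by
      rw [LinearIndependent.pair_iff' hw0]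
      exact fun a ha => hne ⟨a, ha.symm⟩
    have := finrank_span_eq_card hp
    rw [Fintype.card_fin, Matrix.range_cons_cons_empty] at this
    refine this.symm.le.trans (Submodule.finrank_mono ?_)
    exact (Submodule.span_mono (by
      rintro x (rfl | rfl) <;> simp))

theorem iiCollPointsIn_cyc :
    iiCollPointsIn φ T (cyc T v) =
      ⋃ c ∈ {c : F | c ^ 3 = 1}, iiCollPointsIn φ T (invLine T v c) := by
  ext A
  induction A using Projectivization.ind with
  | h w hw0 =>
    simp only [iiCollPointsIn, Set.mem_iUnion, Set.mem_ofPred_eq, mk_submodule_le]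
    constructor
    · rintro ⟨hw, hII⟩
      obtain ⟨c, hc, he⟩ := exists_invLine_of_iiCollPoint h hT hv hw hw0 hII
      exact ⟨c, hc, he ▸ self_mem_cyc w, hII⟩
    · rintro ⟨c, hc, hw, hII⟩
      exact ⟨invLine_le c hw, hII⟩

/-- A II:-point determines its invariant line as the span of its orbit, which makes the union over
the invariant lines disjoint. -/
theorem eq_invLine_of_mem {w : V} (hw0 : w ≠ 0)
    (hII : IsIICollPoint φ T (Projectivization.mk F w hw0)) {c : F} (hc : c ^ 3 = 1)
    (hw : w ∈ invLine T v c) : cyc T w = invLine T v c := by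
  have hvF : LinearIndependent F ![v, T v, T (T v)] := hv.restrict_scalars' F
  obtain ⟨d, -, he⟩ := exists_invLine_of_iiCollPoint h hT hv (invLine_le c hw) hw0 hII
  have : Module.Finite F (invLine T v c) :=
    Module.finite_of_finrank_pos (by rw [finrank_invLine hvF]; norm_num)
  exact Submodule.eq_of_le_of_finrank_eq (cyc_le (isFixed_invLine hT hc) hw)
    (by rw [he, finrank_invLine hvF, finrank_invLine hvF])

theorem ncard_iiCollPointsIn_cyc [Finite F] {n : ℤ}
    (hn : ({c : F | c ^ 2 + c + 1 = 0}.ncard : ℤ) = n + 1) :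
    ((iiCollPointsIn φ T (cyc T v)).ncard : ℤ) =
      {c : F | c ^ 3 = 1}.ncard * (Nat.card F - n) := by
  have hvF : LinearIndependent F ![v, T v, T (T v)] := hv.restrict_scalars' F
  have hfin : ∀ c : F, (iiCollPointsIn φ T (invLine T v c)).Finite := fun c => by
    have hp := ncard_pointsIn (invLine T v c)
    rw [finrank_invLine hvF c] at hp
    simp only [Finset.sum_range_succ, Finset.sum_range_zero, pow_zero, pow_one] at hp
    exact (Set.finite_of_ncard_pos (by omega) : (pointsIn (invLine T v c)).Finite).subset
      fun A hA => hA.1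
  rw [iiCollPointsIn_cyc h hT hv, (Set.toFinite _).ncard_biUnion fun c _ => hfin c]
  · rw [finsum_mem_eq_finite_toFinset_sum _ (Set.toFinite _), Nat.cast_sum,
      Finset.sum_congr rfl (g := fun _ => (Nat.card F : ℤ) - n), Finset.sum_const,
      ← Set.ncard_eq_toFinset_card, nsmul_eq_mul]
    intro c hc
    exact ncard_iiCollPointsIn_invLine h hT hv (by simpa using hc) hn
  · intro c hc d hd hcd
    refine Set.disjoint_left.2 fun A => ?_
    induction A using Projectivization.ind with
    | h w hw0 =>
      simp only [iiCollPointsIn, Set.mem_ofPred_eq, mk_submodule_le]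
      rintro ⟨hwc, hII⟩ ⟨hwd, -⟩
      exact hcd (invLine_injective hvF hT hc
        ((eq_invLine_of_mem h hT hv hw0 hII hc hwc).symm.trans
          (eq_invLine_of_mem h hT hv hw0 hII hd hwd)))

theorem iiiTriPointsIn_cyc (hV : Module.finrank K V = 3) :
    iiiTriPointsIn φ T (cyc T v) =
      (pointsIn (cyc T v) \ fixedPointsIn T (cyc T v)) \ iiCollPointsIn φ T (cyc T v) := by
  ext A
  induction A using Projectivization.ind with
  | h w hw0 =>
    simp only [iiiTriPointsIn, pointsIn, fixedPointsIn, iiCollPointsIn, Set.mem_sdiff,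
      Set.mem_ofPred_eq, mk_submodule_le, isIIITriPoint_mk_iff h]
    by_cases hw : w ∈ cyc T v
    · rw [isIICollPoint_mk_iff h hT hv hw, ← linearIndependent_orbit_iff hV hv hT hw]
      have hnf : LinearIndependent F ![w, T w, T (T w)] →
          sigma T (Projectivization.mk F w hw0) ≠ Projectivization.mk F w hw0 := by
        intro hli he
        obtain ⟨c, hc⟩ := (sigma_mk_eq_iff hw0).1 he
        have := (linearIndependent_triple_iff.1 hli c (-1) 0 (by rw [hc]; module)).2.1
        simp at this
      tauto
    · tauto

theorem ncard_iiiTriPointsIn_cyc [Finite F] (hV : Module.finrank K V = 3) {n : ℤ}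
    (hn : ({c : F | c ^ 2 + c + 1 = 0}.ncard : ℤ) = n + 1) :
    ((iiiTriPointsIn φ T (cyc T v)).ncard : ℤ) =
      (Nat.card F : ℤ) ^ 2 + Nat.card F + 1 -
        {c : F | c ^ 3 = 1}.ncard * (Nat.card F - n + 1) := by
  have hvF : LinearIndependent F ![v, T v, T (T v)] := hv.restrict_scalars' F
  have hp := ncard_pointsIn (cyc T v)
  rw [finrank_cyc hvF] at hp
  simp only [Finset.sum_range_succ, Finset.sum_range_zero, pow_zero, pow_one] at hp
  have hfin : (pointsIn (cyc T v)).Finite := Set.finite_of_ncard_pos (by omega)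
  have h1 := Set.ncard_sdiff_add_ncard_of_subset
    (show fixedPointsIn T (cyc T v) ⊆ pointsIn (cyc T v) from fun A hA => hA.1) hfin
  have h2 := Set.ncard_sdiff_add_ncard_of_subset
    (show iiCollPointsIn φ T (cyc T v) ⊆ pointsIn (cyc T v) \ fixedPointsIn T (cyc T v) from by
      intro A hA
      refine ⟨hA.1, fun hf => ?_⟩
      induction A using Projectivization.ind with
      | h w hw0 =>
        exact ((isIICollPoint_mk_iff h hT hv ((mk_submodule_le hw0).1 hA.1) hw0).1 hA.2).1 hf.2)
    hfin.sdiff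
  rw [← iiiTriPointsIn_cyc h hT hv hV] at h2
  have h3 := ncard_iiCollPointsIn_cyc h hT hv hn
  rw [ncard_fixedPointsIn_cyc hvF hT] at h1
  zify at h1 h2 hp
  linear_combination h1 + h2 + hp - h3

end Plane

end FieldReduction

/-! ### The action on coordinates -/

section Semilinear

variable {F K V : Type*} [Field F] [Field K] [Algebra F K]
  [AddCommGroup V] [Module K V] [Module F V] [IsScalarTower F K V]
  {φ : Equiv.Perm (Projectivization K V)} {T : V ≃ₗ[F] V}

theorem Induces.exists_map_smul (h : Induces T φ) (k : K) (w : V) :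
    ∃ k' : K, T (k • w) = k' • T w := by
  by_cases hw : w = 0
  · exact ⟨0, by simp [hw]⟩
  by_cases hk : k = 0
  · exact ⟨0, by simp [hk]⟩
  have hkw : k • w ≠ 0 := smul_ne_zero hk hw
  have he : Projectivization.mk K (k • w) hkw = Projectivization.mk K w hw :=
    (Projectivization.mk_eq_mk_iff' ..).2 ⟨k, rfl⟩
  have he' := congrArg φ he
  rw [h.apply_mk, h.apply_mk, Projectivization.mk_eq_mk_iff'] at he'
  obtain ⟨a, ha⟩ := he'
  exact ⟨a, ha.symm⟩

theorem Induces.exists_map_smul_of_fixed (h : Induces T φ) {w : V} (hw : w ≠ 0)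
    (hfix : φ (Projectivization.mk K w hw) = Projectivization.mk K w hw) (k : K) :
    ∃ k' : K, T (k • w) = k' • w := by
  rw [h.apply_mk, Projectivization.mk_eq_mk_iff'] at hfix
  obtain ⟨a, ha⟩ := hfix
  obtain ⟨k', hk'⟩ := h.exists_map_smul k w
  exact ⟨k' * a, by rw [hk', ← ha, smul_smul]⟩

/-- If the points with coordinates in `F` are fixed, then `T` acts on coordinates by an
`F`-linear map that is multiplicative up to a scalar. -/
theorem Induces.exists_coord_map (h : Induces T φ) (b : Module.Basis (Fin 3) K V)
    (hb : ∀ (x : Fin 3 → F) (hx : ∑ i, algebraMap F K (x i) • b i ≠ 0),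
      φ (Projectivization.mk K _ hx) = Projectivization.mk K _ hx) :
    ∃ α : K →ₗ[F] K, (∀ k i, T (k • b i) = α k • b i) ∧
      ∀ l k, α l * α k = α 1 * α (l * k) := by
  let α : K →ₗ[F] K := (b.coord 0).restrictScalars F ∘ₗ (T : V →ₗ[F] V) ∘ₗ
    (LinearMap.toSpanSingleton K V (b 0)).restrictScalars F
  have hα : ∀ k, α k = b.repr (T (k • b 0)) 0 := fun k => rfl
  have hsingle : ∀ i (k : K), ∃ k' : K, T (k • b i) = k' • b i := by
    intro i k
    have hsum : ∑ j, algebraMap F K ((Pi.single i 1 : Fin 3 → F) j) • b j = b i := by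
      rw [Finset.sum_eq_single i] <;> simp +contextual
    have hne : ∑ j, algebraMap F K ((Pi.single i 1 : Fin 3 → F) j) • b j ≠ 0 := by
      rw [hsum]; exact b.ne_zero i
    have := h.exists_map_smul_of_fixed hne (hb _ hne) k
    rwa [hsum] at this
  -- The fixed point with all coordinates 1 forces the three coordinate maps to coincide.
  have hones : ∀ k : K, ∃ k' : K, T (k • ∑ j, b j) = k' • ∑ j, b j := by
    intro k
    have hsum : ∑ j, algebraMap F K ((1 : Fin 3 → F) j) • b j = ∑ j, b j := by simp
    have hne : ∑ j, algebraMap F K ((1 : Fin 3 → F) j) • b j ≠ 0 := by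
      intro h0
      have := Fintype.linearIndependent_iff.1 b.linearIndependent _ h0 0
      simp at this
    have := h.exists_map_smul_of_fixed hne (hb _ hne) k
    rwa [hsum] at this
  have hT : ∀ k i, T (k • b i) = α k • b i := by
    intro k i
    choose a ha using fun i => hsingle i k
    obtain ⟨c, hc⟩ := hones k
    rw [Finset.smul_sum, map_sum, Finset.smul_sum] at hc
    simp only [ha] at hc
    have hac : ∀ i, a i = c := fun i => by
      have := Fintype.linearIndependent_iff.1 b.linearIndependent (fun i => a i - c) (by
        simp only [sub_smul, Finset.sum_sub_distrib, hc, sub_self]) i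
      exact sub_eq_zero.1 this
    rw [hα, ha, ha, hac, hac]
    simp
  refine ⟨α, hT, fun l k => ?_⟩
  -- Comparing coordinates gives α(l) = l'α(1) and α(lk) = l'α(k); eliminating l' yields the claim.
  obtain ⟨l', hl'⟩ := h.exists_map_smul l (b 0 + k • b 1)
  have h1 : T (b 0) = α 1 • b 0 := by rw [← hT, one_smul]
  rw [smul_add, smul_smul, map_add, map_add, hT, hT, hT, h1] at hl'
  have h0 := congrArg (fun v => b.repr v 0) hl'
  have h2 := congrArg (fun v => b.repr v 1) hl'
  simp at h0 h2
  rw [h0, h2]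
  ring

end Semilinear

/-! ### Counting III.:-points and fixed-III-planes -/

section Count

variable {F K V : Type*} [Field F] [Field K] [Algebra F K]
  [AddCommGroup V] [Module K V] [Module F V] [IsScalarTower F K V]
  {φ : Equiv.Perm (Projectivization K V)} {T : V ≃ₗ[F] V}

omit [IsScalarTower F K V] in
theorem map_sum_smul {b : Module.Basis (Fin 3) K V} {α : K →ₗ[F] K}
    (hα : ∀ k i, T (k • b i) = α k • b i) (x : Fin 3 → K) :
    T (∑ i, x i • b i) = ∑ i, α (x i) • b i := by
  simp only [map_sum, hα]

/-- Independence of the iterates of a map of order `3` that is multiplicative up to a scalar. -/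
theorem coeff_eq_zero_of_iterates {α : K →ₗ[F] K} (hα1 : α 1 ≠ 0)
    (hmul : ∀ l k, α l * α k = α 1 * α (l * k)) (h3 : ∀ k, α (α (α k)) = k)
    (hne : ¬ ∀ k, α k = α 1 * k) {a b c : K}
    (h : ∀ k, a * k + b * α k + c * α (α k) = 0) : a = 0 ∧ b = 0 ∧ c = 0 := by
  let τ : K →* K :=
    { toFun := fun k => α k / α 1
      map_one' := div_self hα1
      map_mul' := fun l k => by
        field_simp
        rw [mul_comm, ← hmul] }
  have hτ : ∀ k, α k = α 1 * τ k := fun k => by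
    change α k = α 1 * (α k / α 1)
    field_simp
  have hαα : ∀ k, α (α k) = α (α 1) * τ (τ k) := fun k => by
    rw [hτ (α k), hτ k, map_mul, hτ (α 1)]; ring
  have hτ3 : ∀ k, τ (τ (τ k)) = k := fun k => by
    have e1 : ∀ k, α (α (α k)) = α (α (α 1)) * τ (τ (τ k)) := fun k => by
      rw [hαα (α k), hτ k, map_mul, map_mul, hαα (α 1)]; ring
    have := e1 k
    rw [h3, h3, one_mul] at this
    exact this.symm
  have hτ1 : τ ≠ 1 * MonoidHom.id K := by
    intro he
    rw [one_mul] at he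
    exact hne fun k => by rw [hτ, he]; rfl
  rw [one_mul] at hτ1
  have hττ : τ.comp τ ≠ MonoidHom.id K := by
    intro he
    refine hτ1 (MonoidHom.ext fun k => ?_)
    have := DFunLike.congr_fun he (τ k)
    simp only [MonoidHom.comp_apply, hτ3, MonoidHom.id_apply] at this
    exact this.symm
  have hττ' : τ.comp τ ≠ τ := by
    intro he
    refine hττ (MonoidHom.ext fun k => ?_)
    have := congrArg τ (DFunLike.congr_fun he k)
    simp only [MonoidHom.comp_apply, hτ3] at this
    exact this.symm
  have hinj : Function.Injective ![MonoidHom.id K, τ, τ.comp τ] := by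
    intro i j hij
    fin_cases i <;> fin_cases j
    exacts [rfl, (hτ1 hij.symm).elim, (hττ hij.symm).elim, (hτ1 hij).elim, rfl,
      (hττ' hij.symm).elim, (hττ hij).elim, (hττ' hij).elim, rfl]
  -- Dedekind's independence of characters, for the three distinct maps id, τ, τ².
  have hli := (linearIndependent_monoidHom K K).comp _ hinj
  have := Fintype.linearIndependent_iff.1 hli ![a, b * α 1, c * α (α 1)] (by
    ext k
    simp only [Fin.sum_univ_three, Function.comp_apply, Pi.add_apply, Pi.smul_apply,
      smul_eq_mul, Matrix.cons_val_zero, Matrix.cons_val_one, Matrix.cons_val,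
      MonoidHom.id_apply, MonoidHom.comp_apply, Pi.zero_apply]
    rw [← h k, hαα k, hτ k]
    ring)
  have hα2 : α (α 1) ≠ 0 := fun h0 => one_ne_zero ((h3 1).symm.trans (by rw [h0, map_zero]))
  refine ⟨this 0, ?_, ?_⟩
  · simpa [hα1] using this 1
  · simpa [hα2] using this 2

omit [IsScalarTower F K V] in
-- An F-relation between the coordinates survives α, so it defines a K-linear form vanishing on the
-- whole orbit. Conversely, a K-relation r, s, t on the orbit makes r + sα + tα² vanish at each
-- coordinate; if these form an F-basis of K, it vanishes identically, and `hind` applies.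
theorem linearIndependent_orbit_sum_iff (hK : Module.finrank F K = 3)
    {b : Module.Basis (Fin 3) K V} {α : K →ₗ[F] K}
    (hα : ∀ k i, T (k • b i) = α k • b i)
    (hind : ∀ a b c : K, (∀ k, a * k + b * α k + c * α (α k) = 0) → a = 0 ∧ b = 0 ∧ c = 0)
    (x : Fin 3 → K) :
    LinearIndependent K ![∑ i, x i • b i, T (∑ i, x i • b i), T (T (∑ i, x i • b i))] ↔
      LinearIndependent F x := by
  rw [map_sum_smul hα, map_sum_smul hα (fun i => α (x i))]
  constructor
  · intro hli
    rw [Fintype.linearIndependent_iff]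
    intro c hc
    let ℓ : V →ₗ[K] K := b.constr K fun i => algebraMap F K (c i)
    have hℓ : ∀ y : Fin 3 → K, ℓ (∑ i, y i • b i) = ∑ i, c i • y i := fun y => by
      simp only [ℓ, map_sum, map_smul, Module.Basis.constr_basis, smul_eq_mul, Algebra.smul_def,
        mul_comm]
    have h1 : ∑ i, c i • α (x i) = 0 := by
      simp only [← map_smul, ← map_sum, hc, map_zero]
    have h2 : ∑ i, c i • α (α (x i)) = 0 := by
      simp only [← map_smul, ← map_sum, hc, map_zero]
    have : FiniteDimensional K V := Module.Finite.of_basis b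
    have htop := hli.span_eq_top_of_card_eq_finrank' (by
      rw [Module.finrank_eq_card_basis b])
    have hz : ℓ = 0 := by
      refine LinearMap.ext_on_range htop fun i => ?_
      fin_cases i
      · exact (hℓ x).trans hc
      · exact (hℓ fun i => α (x i)).trans h1
      · exact (hℓ fun i => α (α (x i))).trans h2
    intro i
    have : ℓ (b i) = algebraMap F K (c i) := b.constr_basis K _ i
    rw [hz] at this
    simpa using this.symm
  · intro hli
    rw [linearIndependent_triple_iff]
    intro r s t hrst
    refine hind r s t fun k => ?_
    have : FiniteDimensional F K := Module.finite_of_finrank_pos (by omega)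
    have htop := hli.span_eq_top_of_card_eq_finrank' (by rw [hK, Fintype.card_fin])
    let f : K →ₗ[F] K := LinearMap.mulLeft F r + LinearMap.mulLeft F s ∘ₗ α +
      LinearMap.mulLeft F t ∘ₗ α ∘ₗ α
    have hf : f = 0 := by
      refine LinearMap.ext_on_range htop fun i => ?_
      have := Fintype.linearIndependent_iff.1 b.linearIndependent
        (fun i => r * x i + s * α (x i) + t * α (α (x i))) (by
          rw [← hrst]
          simp only [Finset.smul_sum, ← Finset.sum_add_distrib, smul_smul, add_smul]) i
      exact this
    exact DFunLike.congr_fun hf k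

theorem ncard_vectors_of_points (S : Set (Projectivization F V)) [Finite F] :
    {w : V | ∃ hw : w ≠ 0, Projectivization.mk F w hw ∈ S}.ncard =
      S.ncard * (Nat.card F - 1) := by
  let f : S × Fˣ → {w : V | ∃ hw : w ≠ 0, Projectivization.mk F w hw ∈ S} := fun p =>
    ⟨p.2 • p.1.1.rep, by
      have hne : p.2 • p.1.1.rep ≠ 0 := (smul_ne_zero_iff_ne p.2).2 p.1.1.rep_nonzero
      refine ⟨hne, ?_⟩
      have : Projectivization.mk F (p.2 • p.1.1.rep) hne = p.1.1 := by
        conv_rhs => rw [← p.1.1.mk_rep]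
        exact (Projectivization.mk_eq_mk_iff ..).2 ⟨p.2, rfl⟩
      rw [this]
      exact p.1.2⟩
  have hmk : ∀ p (hne : p.2 • p.1.1.rep ≠ 0),
      Projectivization.mk F (p.2 • p.1.1.rep) hne = (p : S × Fˣ).1.1 := by
    intro p hne
    conv_rhs => rw [← p.1.1.mk_rep]
    exact (Projectivization.mk_eq_mk_iff ..).2 ⟨p.2, rfl⟩
  have hbij : Function.Bijective f := by
    constructor
    · intro p p' he
      have he' : p.2 • p.1.1.rep = p'.2 • p'.1.1.rep := congrArg Subtype.val he
      have hne : p.2 • p.1.1.rep ≠ 0 := (smul_ne_zero_iff_ne p.2).2 p.1.1.rep_nonzero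
      have h1 : p.1 = p'.1 := by
        apply Subtype.ext
        rw [← hmk p hne, ← hmk p' (he' ▸ hne)]
        congr 1
      obtain ⟨A, u⟩ := p
      obtain ⟨A', u'⟩ := p'
      obtain rfl : A = A' := h1
      have : ((u : F) - u') • A.1.rep = 0 := by
        rw [sub_smul, sub_eq_zero]; exact he'
      rcases smul_eq_zero.1 this with h0 | h0
      · rw [Units.ext (sub_eq_zero.1 h0)]
      · exact absurd h0 A.1.rep_nonzero
    · rintro ⟨w, hw, hS⟩
      obtain ⟨a, ha⟩ := Projectivization.exists_smul_eq_mk_rep F w hw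
      refine ⟨(⟨_, hS⟩, a⁻¹), Subtype.ext ?_⟩
      change a⁻¹ • (Projectivization.mk F w hw).rep = w
      rw [← ha, inv_smul_smul]
  rw [← Nat.card_coe_set_eq, ← Nat.card_congr (Equiv.ofBijective f hbij), Nat.card_prod,
    Nat.card_units, Nat.card_coe_set_eq]

theorem isFixedIIIPlane_iff (h : Induces T φ) (hT : ∀ v, T (T (T v)) = v) {U : Submodule F V} :
    IsFixedIIIPlane φ T U ↔ ∃ v, LinearIndependent K ![v, T v, T (T v)] ∧ U = cyc T v := by
  constructor
  · rintro ⟨hd, hfix, A, hA⟩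
    induction A using Projectivization.ind with
    | h v hv0 =>
      obtain ⟨hvU, hv⟩ := hA
      rw [mk_submodule_le] at hvU
      rw [isIIITriPoint_mk_iff h] at hv
      exact ⟨v, hv, eq_cyc hd hfix hvU (hv.restrict_scalars' F)⟩
  · rintro ⟨v, hv, rfl⟩
    have hv0 : v ≠ 0 := hv.ne_zero 0
    exact ⟨finrank_cyc (hv.restrict_scalars' F), isFixed_cyc hT v,
      Projectivization.mk F v hv0, (mk_submodule_le hv0).2 (self_mem_cyc v),
      (isIIITriPoint_mk_iff h hv0).2 hv⟩

theorem ncard_iiiTriPoints [Finite F] (hK : Module.finrank F K = 3) (h : Induces T φ)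
    (hT : ∀ v, T (T (T v)) = v) (hφ : φ ≠ 1)
    (hfix : ∃ B : Set (Projectivization K V), IsSubplane F B ∧ ∀ P ∈ B, φ P = P) :
    {A | IsIIITriPoint φ T A}.ncard * (Nat.card F - 1) =
      (Nat.card F ^ 3 - 1) * (Nat.card F ^ 3 - Nat.card F) *
        (Nat.card F ^ 3 - Nat.card F ^ 2) := by
  obtain ⟨B, ⟨b, rfl⟩, hB⟩ := hfix
  obtain ⟨α, hα, hmul⟩ := h.exists_coord_map b fun x hx => hB _ ⟨x, hx, rfl⟩
  have h3 : ∀ k, α (α (α k)) = k := fun k => by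
    have := hT (k • b 0)
    rw [hα, hα, hα, ← sub_eq_zero, ← sub_smul, smul_eq_zero] at this
    exact sub_eq_zero.1 (this.resolve_right (b.ne_zero 0))
  have hα1 : α 1 ≠ 0 := fun h0 => one_ne_zero ((h3 1).symm.trans (by simp only [h0, map_zero]))
  -- Otherwise `T` is multiplication by the scalar α(1), and φ is the identity.
  have hne : ¬ ∀ k, α k = α 1 * k := by
    intro hk
    refine hφ (Equiv.ext fun P => ?_)
    induction P using Projectivization.ind with
    | h w hw =>
      rw [h.apply_mk, Equiv.Perm.one_apply, Projectivization.mk_eq_mk_iff']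
      refine ⟨α 1, ?_⟩
      rw [← b.sum_repr w, map_sum_smul hα, Finset.smul_sum]
      refine Finset.sum_congr rfl fun i _ => ?_
      rw [hk (b.repr w i), smul_smul]
  have hiff := linearIndependent_orbit_sum_iff hK hα fun _ _ _ =>
    coeff_eq_zero_of_iterates hα1 hmul h3 hne
  rw [← ncard_vectors_of_points, ← Nat.card_coe_set_eq]
  have hKfin : FiniteDimensional F K := Module.finite_of_finrank_pos (by omega)
  have hKf : Finite K := Module.finite_of_finite F
  have := Fintype.ofFinite F
  have := Fintype.ofFinite K
  -- The coordinate triples to be counted are the ordered F-bases of K.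
  have hcard := card_linearIndependent (K := F) (V := K) (k := 3) (by rw [hK])
  rw [hK, Fin.prod_univ_three, ← Nat.card_eq_fintype_card] at hcard
  simp only [Fin.val_zero, Fin.val_one, Fin.val_two, pow_zero, pow_one] at hcard
  rw [← hcard]
  refine (Nat.card_congr (b.equivFun.symm.toEquiv.subtypeEquiv fun x => ?_)).symm
  simp only [LinearEquiv.coe_toEquiv, Module.Basis.equivFun_symm_apply, Set.mem_ofPred_eq]
  rw [← hiff]
  constructor
  · intro hli
    exact ⟨hli.ne_zero 0, (isIIITriPoint_mk_iff h _).2 hli⟩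
  · rintro ⟨hw, hli⟩
    exact (isIIITriPoint_mk_iff h hw).1 hli

/-- The fixed-III-planes partition the III.:-points, each lying only in the span of its own orbit.
-/
theorem ncard_isFixedIIIPlane_mul [Finite F] [Finite V] (h : Induces T φ)
    (hT : ∀ v, T (T (T v)) = v) {m : ℕ}
    (hm : ∀ U : Submodule F V, IsFixedIIIPlane φ T U → (iiiTriPointsIn φ T U).ncard = m) :
    {U : Submodule F V | IsFixedIIIPlane φ T U}.ncard * m = {A | IsIIITriPoint φ T A}.ncard := by
  have hset : {A | IsIIITriPoint φ T A} =
      ⋃ U ∈ {U : Submodule F V | IsFixedIIIPlane φ T U}, iiiTriPointsIn φ T U := by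
    ext A
    simp only [Set.mem_iUnion, Set.mem_ofPred_eq, exists_prop]
    constructor
    · intro hA
      induction A using Projectivization.ind with
      | h w hw =>
        exact ⟨cyc T w, (isFixedIIIPlane_iff h hT).2 ⟨w, (isIIITriPoint_mk_iff h hw).1 hA, rfl⟩,
          (mk_submodule_le hw).2 (self_mem_cyc w), hA⟩
    · rintro ⟨U, -, hA⟩
      exact hA.2
  rw [hset, (Set.toFinite _).ncard_biUnion fun _ _ => Set.toFinite _,
    finsum_mem_eq_finite_toFinset_sum _ (Set.toFinite _),
    Finset.sum_congr rfl (g := fun _ => m), Finset.sum_const, ← Set.ncard_eq_toFinset_card,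
    smul_eq_mul]
  · intro U hU
    exact hm U (by simpa using hU)
  · intro U hU U' hU' hne
    refine Set.disjoint_left.2 fun A => ?_
    rintro ⟨hAU, hA⟩ ⟨hAU', -⟩
    induction A using Projectivization.ind with
    | h w hw =>
      rw [mk_submodule_le] at hAU hAU'
      rw [isIIITriPoint_mk_iff h] at hA
      exact hne ((eq_cyc hU.1 hU.2.1 hAU (hA.restrict_scalars' F)).trans
        (eq_cyc hU'.1 hU'.2.1 hAU' (hA.restrict_scalars' F)).symm)

end Count

end Bose

theorem theorem20 {F K V : Type*} [Field F] [Finite F] [Field K] [Algebra F K]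
    [AddCommGroup V] [Module K V] [Module F V] [IsScalarTower F K V]
    (hK : Module.finrank F K = 3) (hV : Module.finrank K V = 3)
    (q : ℕ) (hF : Nat.card F = q) (hq : 2 < q)
    (g : ℕ) (hg : g = Nat.gcd 3 (q - 1))
    (n : ℤ) (hn : n = -1 ∨ n = 0 ∨ n = 1) (hqn : (q : ℤ) ≡ n [ZMOD 3])
    (φ : Equiv.Perm (Projectivization K V)) (hφ : Bose.IsCollineation φ) (hord : orderOf φ = 3)
    (hfix : ∃ B : Set (Projectivization K V), Bose.IsSubplane F B ∧ ∀ P ∈ B, φ P = P)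
    (T : V ≃ₗ[F] V) (hT : ∀ v, T (T (T v)) = v) (hTφ : Bose.Induces T φ) :
    (({U : Submodule F V | Bose.IsFixedIIIPlane φ T U}.ncard : ℚ) =
      (q : ℚ) ^ 3 * ((q : ℚ) ^ 2 - 1) * ((q : ℚ) - 1) * ((q : ℚ) ^ 2 + q + 1) /
        ((q : ℚ) ^ 2 + q + 1 - g * (q - n + 1))) ∧
    ∀ U : Submodule F V, Bose.IsFixedIIIPlane φ T U →
      (Bose.fixedPointsIn T U).ncard = g ∧
      ((Bose.iiCollPointsIn φ T U).ncard : ℤ) = g * (q - n) ∧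
      ((Bose.iiiTriPointsIn φ T U).ncard : ℤ) = (q : ℤ) ^ 2 + q + 1 - g * (q - n + 1) ∧
      {l : Submodule F V | l ≤ U ∧ Bose.IsFixedIILine n φ T l}.ncard = g := by
  subst hF
  obtain ⟨hR, hE⟩ := Bose.ncard_roots (F := F) hg hn hqn
  have hplane : ∀ U : Submodule F V, Bose.IsFixedIIIPlane φ T U →
      (Bose.fixedPointsIn T U).ncard = g ∧
      ((Bose.iiCollPointsIn φ T U).ncard : ℤ) = g * (Nat.card F - n) ∧
      ((Bose.iiiTriPointsIn φ T U).ncard : ℤ) =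
        (Nat.card F : ℤ) ^ 2 + Nat.card F + 1 - g * (Nat.card F - n + 1) ∧
      {l : Submodule F V | l ≤ U ∧ Bose.IsFixedIILine n φ T l}.ncard = g := by
    intro U hU
    obtain ⟨v, hv, rfl⟩ := (Bose.isFixedIIIPlane_iff hTφ hT).1 hU
    rw [← hE]
    exact ⟨Bose.ncard_fixedPointsIn_cyc (hv.restrict_scalars' F) hT,
      Bose.ncard_iiCollPointsIn_cyc hTφ hT hv hR,
      Bose.ncard_iiiTriPointsIn_cyc hTφ hT hv hV hR,
      Bose.ncard_isFixedIILine hTφ hT hv hR⟩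
  refine ⟨?_, hplane⟩
  have : Module.Finite F K := Module.finite_of_finrank_pos (by omega)
  have : Module.Finite K V := Module.finite_of_finrank_pos (by omega)
  have : Module.Finite F V := Module.Finite.trans K V
  have : Finite V := Module.finite_of_finite F
  have hφ1 : φ ≠ 1 := by
    rintro rfl
    simp at hord
  have hM := Bose.ncard_iiiTriPoints hK hTφ hT hφ1 hfix
  set q := Nat.card F
  set m := ((q : ℤ) ^ 2 + q + 1 - g * (q - n + 1)).toNat with hm
  have hN := Bose.ncard_isFixedIIIPlane_mul hTφ hT (m := m) fun U hU => by
    rw [hm, ← (hplane U hU).2.2.1, Int.toNat_natCast]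
  rw [← hN] at hM
  have hq1 : 1 ≤ q := by omega
  have e1 : q ≤ q ^ 3 := Nat.le_self_pow (by norm_num) q
  have e2 : q ^ 2 ≤ q ^ 3 := Nat.pow_le_pow_right hq1 (by norm_num)
  have e3 : 1 ≤ q ^ 3 := Nat.one_le_pow _ _ hq1
  have hMQ : (({U : Submodule F V | Bose.IsFixedIIIPlane φ T U}.ncard : ℚ) * m) * (q - 1) =
      ((q : ℚ) ^ 3 - 1) * ((q : ℚ) ^ 3 - q) * ((q : ℚ) ^ 3 - (q : ℚ) ^ 2) := by
    have := congrArg (Nat.cast : ℕ → ℚ) hM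
    push_cast [hq1, e1, e2, e3] at this
    exact this
  have hqQ : (2 : ℚ) < q := by exact_mod_cast hq
  have hq0 : (q : ℚ) - 1 ≠ 0 := by linarith
  have hMQ' : ({U : Submodule F V | Bose.IsFixedIIIPlane φ T U}.ncard : ℚ) * m =
      (q : ℚ) ^ 3 * ((q : ℚ) ^ 2 - 1) * ((q : ℚ) - 1) * ((q : ℚ) ^ 2 + q + 1) := by
    apply mul_right_cancel₀ hq0
    rw [hMQ]
    ring
  have hpos : 0 < (q : ℚ) ^ 3 * ((q : ℚ) ^ 2 - 1) * ((q : ℚ) - 1) * ((q : ℚ) ^ 2 + q + 1) := by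
    have h1 : 0 < (q : ℚ) - 1 := by linarith
    have h2 : 0 < (q : ℚ) ^ 2 - 1 := by nlinarith
    positivity
  -- The product of m with the number of planes is positive. Hence m ≠ 0, which allows the division
  -- and shows that `Int.toNat` did not truncate a negative value.
  have hm0 : m ≠ 0 := by
    intro h0
    rw [← hMQ', h0] at hpos
    simp at hpos
  have hmQ : (m : ℚ) = (q : ℚ) ^ 2 + q + 1 - g * (q - n + 1) := by
    have : (m : ℤ) = (q : ℤ) ^ 2 + q + 1 - g * (q - n + 1) :=
      Int.toNat_of_nonneg (by omega)
    exact_mod_cast congrArg (Int.cast : ℤ → ℚ) this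
  rw [← hmQ, ← hMQ', mul_div_cancel_right₀]
  exact_mod_cast hm0
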